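/- Let a group $G$ act on a simplicial tree $T$ by simplicial automorphisms without inversions, each edge having length $1$. For $g\in G$ let $|g|=\min_{x\in T} d(x,gx)$ be its translation length; $g$ is hyperbolic if $|g|>0$. Let $K\ge 0$ be a real number and suppose that the action is $K$-acylindrical, i.e. the pointwise stabilizer of every segment of length $K$ in $T$ is trivial. Let $N=\lceil K/2+1\rceil$. Let $\mathrm{scl}(g)=\lim_{n\to\infty}\mathrm{cl}(g^{n})/n$ be the stable commutator length (where $\mathrm{cl}(x)$ is the least number of commutators in $G$ whose product is $x$), with the usual conventions $\mathrm{scl}(g)=\mathrm{scl}(g^k)/k$ if $g^k\in[G,G]$ for some $k\ge1$, and $\mathrm{scl}(g)=\infty$ if no positive power of $g$ lies in $[G,G]$. Then for every hyperbolic $g\in G$: 1. either $\mathrm{scl}(g)=0$ or $\mathrm{scl}(g)\ge \frac{1}{12N}$; 2. if $|g|\ge K$, then either $\mathrm{scl}(g)=0$ or $\mathrm{scl}(g)\ge \frac1{24}$. In both cases, $\mathrm{scl}(g)=0$ if and only if $g$ is conjugate to $g^{-1}$ in $G$. -/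

import Mathlib

open scoped ENNReal

/-- The commutator length of `g`: the least number of commutators whose product is `g`, and `⊤`
if `g` is not a product of commutators. -/
noncomputable def commutatorLength {G : Type*} [Group G] (g : G) : ℕ∞ :=
  sInf {n : ℕ∞ | ∃ l : List G, (∀ x ∈ l, x ∈ commutatorSet G) ∧ l.prod = g ∧ (l.length : ℕ∞) = n}

/-- The stable commutator length `scl g = lim cl (g ^ n) / n`.

If `g` lies in `[G, G]` the limit exists, by subadditivity of `n ↦ cl (g ^ n)`, and the `liminf`
is that limit. If `k ≥ 1` is least with `g ^ k ∈ [G, G]`, then `cl (g ^ n) = ∞` unless `k ∣ n`, so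
the `liminf` is the limit along the multiples of `k`, which is `scl (g ^ k) / k`. If no positive
power of `g` lies in `[G, G]`, the value is `∞`. -/
noncomputable def stableCommutatorLength {G : Type*} [Group G] (g : G) : ℝ≥0∞ :=
  Filter.liminf (fun n : ℕ => (commutatorLength (g ^ n) : ℝ≥0∞) / (n : ℝ≥0∞)) Filter.atTop

/-- `T` is a simplicial tree with vertex set `V`, and the action of `G` on `V` is an action on `T`
by graph automorphisms without inversions. -/
structure IsTreeAction (G : Type*) [Group G] {V : Type*} [MulAction G V] (T : SimpleGraph V) :
    Prop where
  isTree : T.IsTree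
  adj_smul : ∀ (g : G) (u v : V), T.Adj u v → T.Adj (g • u) (g • v)
  not_inversion : ∀ (g : G) (u v : V), T.Adj u v → ¬ (g • u = v ∧ g • v = u)

/-- The translation length `|g|`: the minimum of the displacement `d(v, g v)`. For an action
without inversions the minimum over all points of the tree is attained at a vertex. -/
noncomputable def translationLength {G : Type*} [Group G] {V : Type*} [MulAction G V]
    (T : SimpleGraph V) (g : G) : ℕ :=
  ⨅ v : V, T.dist v (g • v)

/-- `g` is hyperbolic if its translation length is not zero. -/
def IsHyperbolic {G : Type*} [Group G] {V : Type*} [MulAction G V]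
    (T : SimpleGraph V) (g : G) : Prop :=
  translationLength T g ≠ 0

/-- The action is `K`-acylindrical: the pointwise stabilizer of every segment of length `K` is
trivial.

Here `K` is real and segments may end inside edges. As there are no inversions, an element that
fixes a point inside an edge fixes the edge; so an element fixing a segment of length `K` pointwise
fixes an edge path of length at least `K` (the union of the edges whose interior the segment meets,
or a vertex). Conversely an edge path of length at least `K` contains a segment of length `K` that
meets the interior of `⌈K⌉` edges. Hence only edge paths have to be considered. -/
def IsAcylindricalAction (G : Type*) [Group G] {V : Type*} [MulAction G V]
    (T : SimpleGraph V) (K : ℝ) : Prop :=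
  ∀ (u v : V) (p : T.Walk u v), p.IsPath → K ≤ (p.length : ℝ) →
    ∀ g : G, (∀ w ∈ p.support, g • w = w) → g = 1

/-! The positive lower bounds come from a Brooks-type counting quasimorphism. Let `o` be a vertex of
least displacement, so that the points `g ^ n • o` lie along the axis of `g`, and let `M = m + 1`.
On a geodesic, count disjoint translates of the oriented segment from `o` to `g ^ M • o`, and
subtract the count in the opposite direction. Cutting a geodesic loses at most one copy, so medians
of triangles give defect at most 3 (`abs_countingQuasimorphism_mul_le`). Being antisymmetric, the
function grows by at most 12 per commutator.

If no translate runs backwards along the axis, the value at `g ^ n` is at least `n / M`, so scl is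
at least `1 / (12 * M)`. If `h` does reverse a copy, `h⁻¹ * g * h * g` fixes a segment of length `m
* |g|`; once this is at least `K`, acylindricity makes `g` conjugate to its inverse
(`isConj_inv_of_reversed`). If `|g| = 1`, a reversed copy would produce an inversion, so only `|g| ≥
2` matters and `m ≥ K / 2` suffices. Conversely, if `g` is conjugate to its inverse, all its even
powers are single commutators and scl vanishes. -/

namespace SimpleGraph

/-! ### Metric geometry of trees. -/

variable {V : Type*} {T : SimpleGraph V}

theorem Walk.IsPath.length_eq_dist_of_isTree (hT : T.IsTree) {u v : V} {p : T.Walk u v}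
    (hp : p.IsPath) : p.length = T.dist u v := by
  obtain ⟨q, hq, hlen⟩ := hT.connected.exists_path_of_dist u v
  rw [(hT.existsUnique_path u v).unique hp hq, hlen]

theorem Walk.IsPath.dist_add_dist_of_mem_support (hT : T.IsTree) {u v x : V} {p : T.Walk u v}
    (hp : p.IsPath) (hx : x ∈ p.support) : T.dist u x + T.dist x v = T.dist u v := by
  classical
  rw [← (hp.takeUntil hx).length_eq_dist_of_isTree hT,
    ← (hp.dropUntil hx).length_eq_dist_of_isTree hT, ← hp.length_eq_dist_of_isTree hT,
    ← Walk.length_append, Walk.take_spec]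

theorem IsTree.mem_support_of_dist_add_dist (hT : T.IsTree) {u v x : V} {p : T.Walk u v}
    (hp : p.IsPath) (hx : T.dist u x + T.dist x v = T.dist u v) : x ∈ p.support := by
  obtain ⟨q, -, hq⟩ := hT.connected.exists_path_of_dist u x
  obtain ⟨r, -, hr⟩ := hT.connected.exists_path_of_dist x v
  have hqr : (q.append r).IsPath :=
    Walk.isPath_of_length_eq_dist _ (by rw [Walk.length_append, hq, hr, hx])
  rw [(hT.existsUnique_path u v).unique hp hqr, Walk.mem_support_append_iff]
  exact Or.inl q.end_mem_support

theorem IsTree.exists_dist_eq (hT : T.IsTree) {u v : V} {k : ℕ} (hk : k ≤ T.dist u v) :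
    ∃ x, T.dist u x = k ∧ T.dist x v = T.dist u v - k := by
  obtain ⟨p, hp, hlen⟩ := hT.connected.exists_path_of_dist u v
  have h := (hp.take k).length_eq_dist_of_isTree hT
  have h' := hp.dist_add_dist_of_mem_support hT (p.getVert_mem_support k)
  rw [Walk.take_length] at h
  exact ⟨p.getVert k, by omega, by omega⟩

/-- Two points of a geodesic divide it into three parts. -/
theorem IsTree.dist_add_dist_or (hT : T.IsTree) {u w x y : V}
    (hx : T.dist u x + T.dist x w = T.dist u w) (hy : T.dist u y + T.dist y w = T.dist u w) :
    T.dist u y + T.dist y x = T.dist u x ∨ T.dist x y + T.dist y w = T.dist x w := by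
  classical
  obtain ⟨p, hp, -⟩ := hT.connected.exists_path_of_dist u w
  have hxp := hT.mem_support_of_dist_add_dist hp hx
  have hyp := hT.mem_support_of_dist_add_dist hp hy
  rw [← p.take_spec hxp, Walk.mem_support_append_iff] at hyp
  exact hyp.imp ((hp.takeUntil hxp).dist_add_dist_of_mem_support hT)
    ((hp.dropUntil hxp).dist_add_dist_of_mem_support hT)

/-- A geodesic from `v` to a nearest point `m` of `p` meets `p` only at `m`, so the two concatenate
to a path. -/
theorem IsTree.dist_add_dist_of_forall_le (hT : T.IsTree) {v m w : V} {p : T.Walk m w}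
    (hp : p.IsPath) (h : ∀ x ∈ p.support, T.dist v m ≤ T.dist v x) :
    T.dist v m + T.dist m w = T.dist v w := by
  obtain ⟨q, hq, hqlen⟩ := hT.connected.exists_path_of_dist v m
  have hpath : (q.append p).IsPath := by
    rw [Walk.isPath_def, Walk.support_append, List.nodup_append]
    have hnodup := hp.support_nodup
    rw [← Walk.cons_tail_support, List.nodup_cons] at hnodup
    refine ⟨hq.support_nodup, hnodup.2, ?_⟩
    rintro x hxq _ hxp rfl
    have h₁ := hq.dist_add_dist_of_mem_support hT hxq
    have h₂ := h x (List.mem_of_mem_tail hxp)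
    have h₃ : x = m := hT.connected.dist_eq_zero_iff.1 (by omega)
    exact hnodup.1 (h₃ ▸ hxp)
  rw [← hpath.length_eq_dist_of_isTree hT, Walk.length_append, hqlen,
    hp.length_eq_dist_of_isTree hT]

/-- Any three vertices of a tree have a median. -/
theorem IsTree.exists_median (hT : T.IsTree) (u v w : V) :
    ∃ m, T.dist u m + T.dist m v = T.dist u v ∧ T.dist v m + T.dist m w = T.dist v w ∧
      T.dist u m + T.dist m w = T.dist u w := by
  classical
  obtain ⟨p, hp, -⟩ := hT.connected.exists_path_of_dist u w
  obtain ⟨m, hm, hmin⟩ := p.support.toFinset.exists_min_image (T.dist v)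
    ⟨u, List.mem_toFinset.2 p.start_mem_support⟩
  simp only [List.mem_toFinset] at hm hmin
  refine ⟨m, ?_, ?_, hp.dist_add_dist_of_mem_support hT hm⟩
  · have := hT.dist_add_dist_of_forall_le (v := v) (hp.takeUntil hm).reverse fun x hx =>
      hmin x (p.support_takeUntil_subset_support hm (by simpa using hx))
    rw [T.dist_comm (u := u) (v := m), T.dist_comm (u := m) (v := v), T.dist_comm (u := u) (v := v)]
    omega
  · exact hT.dist_add_dist_of_forall_le (hp.dropUntil hm) fun x hx =>
      hmin x (p.support_dropUntil_subset_support hm hx)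

/-- The four-point condition. -/
theorem IsTree.four_point (hT : T.IsTree) (x y z t : V) :
    T.dist x z + T.dist y t ≤
      max (T.dist x y + T.dist z t) (T.dist x t + T.dist y z) := by
  obtain ⟨m, h₁, h₂, h₃⟩ := hT.exists_median t x y
  obtain ⟨n, k₁, k₂, k₃⟩ := hT.exists_median t z y
  have c₁ := T.dist_comm (u := x) (v := m)
  have c₂ := T.dist_comm (u := z) (v := n)
  have c₃ := T.dist_comm (u := m) (v := n)
  have c₄ := T.dist_comm (u := x) (v := t)
  have c₅ := T.dist_comm (u := z) (v := t)
  have c₆ := T.dist_comm (u := y) (v := t)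
  have c₇ := T.dist_comm (u := y) (v := z)
  have a₁ := hT.connected.dist_triangle (u := x) (v := m) (w := z)
  have a₂ := hT.connected.dist_triangle (u := m) (v := n) (w := z)
  -- Both medians lie on the geodesic from `t` to `y`; their order there decides which sum
  -- dominates.
  rcases hT.dist_add_dist_or h₃ k₃ with h | h <;> omega

theorem IsTree.eq_of_dist_eq (hT : T.IsTree) {u w x y : V}
    (hx : T.dist u x + T.dist x w = T.dist u w) (hy : T.dist u y + T.dist y w = T.dist u w)
    (h : T.dist u x = T.dist u y) : x = y := by
  have c := T.dist_comm (u := x) (v := y)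
  apply hT.connected.dist_eq_zero_iff.1
  rcases hT.dist_add_dist_or hx hy with h' | h' <;> omega

/-- Geodesics that overlap in a nondegenerate segment fit together to a geodesic. -/
theorem IsTree.dist_eq_of_overlap (hT : T.IsTree) {x y z t : V} (hyz : y ≠ z)
    (h₁ : T.dist x y + T.dist y z = T.dist x z) (h₂ : T.dist y z + T.dist z t = T.dist y t) :
    T.dist x t = T.dist x y + T.dist y z + T.dist z t := by
  have h := hT.four_point x y z t
  -- Positivity of `d(y, z)` rules out the first term of the maximum.
  have h₃ := hT.connected.pos_dist_of_ne hyz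
  have a₁ := hT.connected.dist_triangle (u := x) (v := y) (w := t)
  omega

end SimpleGraph

/-! ### Quasimorphisms and stable commutator length. -/

section CommutatorLength

variable {G : Type*} [Group G]

open Filter Topology

/-- An antisymmetric quasimorphism of defect `D` grows by at most `4 * D` per commutator. -/
theorem abs_prod_le_of_forall_mem_commutatorSet {φ : G → ℤ} {D : ℤ}
    (hinv : ∀ a, φ a⁻¹ = -φ a) (hmul : ∀ a b, |φ (a * b) - φ a - φ b| ≤ D) (l : List G)
    (hl : ∀ x ∈ l, x ∈ commutatorSet G) : |φ l.prod| ≤ 4 * D * l.length := by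
  induction l with
  | nil =>
    have := hinv 1
    rw [inv_one] at this
    simp only [List.prod_nil, List.length_nil, Nat.cast_zero, mul_zero, abs_nonpos_iff]
    omega
  | cons c l ih =>
    obtain ⟨a, b, rfl⟩ := hl c List.mem_cons_self
    have ih' := ih fun x hx => hl x (List.mem_cons_of_mem _ hx)
    -- Three products build the commutator and a fourth attaches it to the rest; the values at `a`,
    -- `b` and their inverses cancel.
    have h₁ := hmul a b
    have h₂ := hmul (a * b) a⁻¹
    have h₃ := hmul (a * b * a⁻¹) b⁻¹
    have h₄ := hmul (a * b * a⁻¹ * b⁻¹) l.prod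
    rw [hinv] at h₂ h₃
    rw [List.prod_cons, List.length_cons, commutatorElement_def]
    push_cast
    rw [abs_le] at *
    constructor <;> linarith

theorem natAbs_le_mul_commutatorLength {φ : G → ℤ} {D : ℕ} (hD : D ≠ 0)
    (hinv : ∀ a, φ a⁻¹ = -φ a) (hmul : ∀ a b, |φ (a * b) - φ a - φ b| ≤ D) (g : G) :
    ((φ g).natAbs : ℕ∞) ≤ 4 * D * commutatorLength g := by
  rcases Set.eq_empty_or_nonempty {n : ℕ∞ | ∃ l : List G, (∀ x ∈ l, x ∈ commutatorSet G) ∧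
    l.prod = g ∧ (l.length : ℕ∞) = n} with h | h
  -- Outside `[G, G]` the right side is `⊤`; `D ≠ 0` keeps the product from collapsing to 0.
  · rw [commutatorLength, h, sInf_empty, ENat.mul_top (by simpa using hD)]
    exact le_top
  · obtain ⟨l, hl, hg, hn⟩ := csInf_mem h
    have := abs_prod_le_of_forall_mem_commutatorSet hinv hmul l hl
    rw [hg] at this
    rw [commutatorLength, ← hn]
    have h' : (φ g).natAbs ≤ 4 * D * l.length := by zify; exact this
    exact_mod_cast h'

theorem commutatorLength_le_one {g : G} (hg : g ∈ commutatorSet G) : commutatorLength g ≤ 1 :=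
  sInf_le ⟨[g], by simpa using hg, by simp, by simp⟩

/-- Rounding down in `n / M` costs less than 1, which disappears after division by `n`. -/
theorem inv_le_stableCommutatorLength {g : G} {M C : ℕ} (hM : M ≠ 0) (hC : C ≠ 0)
    (h : ∀ n, ((n / M : ℕ) : ℕ∞) ≤ C * commutatorLength (g ^ n)) :
    1 / (C * (M : ℝ≥0∞)) ≤ stableCommutatorLength g := by
  have hM' : (0 : ℝ) < M := by positivity
  have hC' : (0 : ℝ) < C := by positivity
  have hlim : Tendsto (fun n : ℕ => ENNReal.ofReal (1 / (C * M) - (C : ℝ)⁻¹ / n)) atTop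
      (𝓝 (1 / (C * (M : ℝ≥0∞)))) := by
    have h₁ := (tendsto_const_div_atTop_nhds_zero_nat (C⁻¹ : ℝ)).const_sub (1 / (C * M : ℝ))
    have h₂ := ENNReal.tendsto_ofReal h₁
    rwa [sub_zero, ENNReal.ofReal_div_of_pos (by positivity), ENNReal.ofReal_mul hC'.le,
      ENNReal.ofReal_natCast, ENNReal.ofReal_natCast, ENNReal.ofReal_one] at h₂
  rw [← hlim.liminf_eq, stableCommutatorLength]
  refine liminf_le_liminf ?_
  filter_upwards [eventually_gt_atTop 0] with n hn
  have hn' : (0 : ℝ) < n := by positivity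
  rw [ENNReal.le_div_iff_mul_le (by simp [hn.ne']) (by simp)]
  have h₁ : ((n / M : ℕ) : ℝ≥0∞) ≤ C * commutatorLength (g ^ n) := by
    exact_mod_cast ENat.toENNReal_le.2 (h n)
  have hdiv : (n : ℝ) ≤ M * (n / M : ℕ) + M := by
    have := Nat.div_add_mod n M
    have := Nat.mod_lt n (Nat.pos_of_ne_zero hM)
    exact_mod_cast (by omega : n ≤ M * (n / M) + M)
  have h₂ : ENNReal.ofReal (1 / (C * M) - (C : ℝ)⁻¹ / n) * n ≤ ((n / M : ℕ) : ℝ≥0∞) / C := by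
    rw [← ENNReal.ofReal_natCast n, ← ENNReal.ofReal_mul' hn'.le,
      ← ENNReal.ofReal_natCast (n / M), ← ENNReal.ofReal_natCast C,
      ← ENNReal.ofReal_div_of_pos hC']
    apply ENNReal.ofReal_le_ofReal
    rw [le_div_iff₀ hC']
    have : (1 / (C * M) - (C : ℝ)⁻¹ / n) * n * C = (n - M) / M := by field_simp
    rw [this, div_le_iff₀ hM']
    linarith
  refine h₂.trans ?_
  exact ENNReal.div_le_of_le_mul' h₁

/-- If `h` conjugates `g` to its inverse, then `g ^ (2 * k) = ⁅g ^ k, h⁆`; the `liminf` along even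
exponents is therefore 0. -/
theorem stableCommutatorLength_eq_zero_of_isConj_inv {g : G} (hg : IsConj g g⁻¹) :
    stableCommutatorLength g = 0 := by
  obtain ⟨h, hh⟩ := isConj_iff.1 hg
  have hcomm (k : ℕ) : commutatorLength (g ^ (2 * k)) ≤ 1 := by
    refine commutatorLength_le_one ⟨g ^ k, h, ?_⟩
    have : h * (g ^ k)⁻¹ * h⁻¹ = g ^ k := by
      rw [← inv_pow, ← conj_pow, ← conj_inv, hh, inv_inv]
    rw [commutatorElement_def, mul_assoc, mul_assoc, ← mul_assoc h, this, two_mul, pow_add]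
  have htwo : Tendsto (fun k : ℕ => 2 * k) atTop atTop :=
    tendsto_id.const_mul_atTop' two_pos
  refine le_antisymm ?_ zero_le
  calc stableCommutatorLength g
      ≤ liminf (fun n : ℕ => (commutatorLength (g ^ n) : ℝ≥0∞) / (n : ℝ≥0∞))
          (map (fun k : ℕ => 2 * k) atTop) := liminf_le_liminf_of_le htwo
    _ ≤ liminf (fun k : ℕ => ((2 * k : ℕ) : ℝ≥0∞)⁻¹) atTop := by
        rw [← liminf_comp]
        refine liminf_le_liminf (Eventually.of_forall fun k => ?_)
        have : (commutatorLength (g ^ (2 * k)) : ℝ≥0∞) ≤ 1 := by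
          exact_mod_cast ENat.toENNReal_le.2 (hcomm k)
        rw [← one_div]
        exact ENNReal.div_le_div_right this _
    _ = 0 := (ENNReal.tendsto_inv_nat_nhds_zero.comp htwo).liminf_eq

end CommutatorLength

/-! ### Counting translates of a segment on geodesics. -/

section CopyCount

variable {G : Type*} [Group G] {V : Type*} [MulAction G V] {T : SimpleGraph V}

theorem IsTreeAction.dist_smul_smul (hT : IsTreeAction G T) (g : G) (u v : V) :
    T.dist (g • u) (g • v) = T.dist u v := by
  have key (g : G) (u v : V) : T.dist (g • u) (g • v) ≤ T.dist u v := by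
    obtain ⟨p, hp⟩ := hT.isTree.connected.exists_walk_length_eq_dist u v
    let f : T →g T := ⟨fun x => g • x, fun h => hT.adj_smul g _ _ h⟩
    have := SimpleGraph.dist_le (p.map f)
    rwa [SimpleGraph.Walk.length_map, hp] at this
  refine (key g u v).antisymm ?_
  simpa using key g⁻¹ (g • u) (g • v)

/-- `CopyChain G T p q u v n` says that the geodesic from `u` to `v` contains `n` successive
non-overlapping translates of the oriented segment from `p` to `q`. -/
inductive CopyChain (G : Type*) [Group G] {V : Type*} [MulAction G V] (T : SimpleGraph V)
    (p q : V) : V → V → ℕ → Prop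
  | zero (u v : V) : CopyChain G T p q u v 0
  | succ (h : G) {u v : V} {n : ℕ}
      (hd : T.dist u (h • p) + T.dist (h • p) (h • q) + T.dist (h • q) v = T.dist u v)
      (hc : CopyChain G T p q (h • q) v n) : CopyChain G T p q u v (n + 1)

namespace CopyChain

variable {p q u v w : V} {n m : ℕ}

theorem mul_dist_le (hT : IsTreeAction G T) (h : CopyChain G T p q u v n) :
    n * T.dist p q ≤ T.dist u v := by
  induction h with
  | zero => simp
  | succ h hd _ ih =>
    rw [hT.dist_smul_smul] at hd
    rw [add_one_mul]
    omega

theorem smul (hT : IsTreeAction G T) (g : G) (h : CopyChain G T p q u v n) :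
    CopyChain G T p q (g • u) (g • v) n := by
  induction h with
  | zero => exact .zero _ _
  | succ h hd _ ih =>
    refine .succ (g * h) ?_ (by rwa [mul_smul])
    simpa only [mul_smul, hT.dist_smul_smul] using hd

theorem mono_left (hT : IsTreeAction G T) (hv : T.dist u v + T.dist v w = T.dist u w)
    (h : CopyChain G T p q v w n) : CopyChain G T p q u w n := by
  cases h with
  | zero => exact .zero _ _
  | succ h hd hc =>
    refine .succ h ?_ hc
    have conn := hT.isTree.connected
    have a₁ := conn.dist_triangle (u := u) (v := v) (w := h • p)
    have a₂ := conn.dist_triangle (u := u) (v := h • p) (w := w)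
    have a₃ := conn.dist_triangle (u := h • p) (v := h • q) (w := w)
    omega

theorem append (hT : IsTreeAction G T) (hv : T.dist u v + T.dist v w = T.dist u w)
    (h₁ : CopyChain G T p q u v n) (h₂ : CopyChain G T p q v w m) :
    CopyChain G T p q u w (m + n) := by
  induction h₁ with
  | zero => exact h₂.mono_left hT hv
  | @succ h u v n hd _ ih =>
    have conn := hT.isTree.connected
    have a₁ := conn.dist_triangle (u := u) (v := h • p) (w := w)
    have a₂ := conn.dist_triangle (u := h • p) (v := h • q) (w := w)
    have a₃ := conn.dist_triangle (u := h • q) (v := v) (w := w)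
    exact .succ h (by omega) (ih (by omega) h₂)

/-- The copies do not overlap, so at most one straddles the cut point `v`; the `+ 1` pays for it. -/
theorem exists_split (hT : IsTreeAction G T) (hv : T.dist u v + T.dist v w = T.dist u w)
    (h : CopyChain G T p q u w n) : ∃ a b, n ≤ a + b + 1 ∧
      CopyChain G T p q u v a ∧ CopyChain G T p q v w b := by
  induction h with
  | zero => exact ⟨0, 0, by omega, .zero _ _, .zero _ _⟩
  | @succ h u w n hd hc ih =>
    have conn := hT.isTree.connected
    have a₁ := conn.dist_triangle (u := u) (v := h • p) (w := h • q)
    have a₂ := conn.dist_triangle (u := u) (v := h • q) (w := w)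
    rcases hT.isTree.dist_add_dist_or (x := h • q) (y := v) (by omega) hv with h' | h'
    · exact ⟨0, n, by omega, .zero _ _, hc.mono_left hT (by omega)⟩
    · obtain ⟨a, b, hn, ha, hb⟩ := ih h'
      exact ⟨a + 1, b, by omega, .succ h (by omega) ha, hb⟩

end CopyChain

/-- The largest number of non-overlapping translates of the oriented segment from `p` to `q` on the
geodesic from `u` to `v`. -/
noncomputable def copyCount (G : Type*) [Group G] {V : Type*} [MulAction G V] (T : SimpleGraph V)
    (p q u v : V) : ℕ :=
  sSup {n | CopyChain G T p q u v n}

variable {p q : V}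

theorem CopyChain.bddAbove (hT : IsTreeAction G T) (hpq : p ≠ q) (u v : V) :
    BddAbove {n | CopyChain G T p q u v n} := by
  refine ⟨T.dist u v, fun n hn => ?_⟩
  have := hT.isTree.connected.pos_dist_of_ne hpq
  exact (Nat.le_mul_of_pos_right n this).trans (hn.mul_dist_le hT)

theorem copyChain_copyCount (hT : IsTreeAction G T) (hpq : p ≠ q) (u v : V) :
    CopyChain G T p q u v (copyCount G T p q u v) :=
  Nat.sSup_mem (s := {n | CopyChain G T p q u v n}) ⟨0, .zero u v⟩
    (CopyChain.bddAbove hT hpq u v)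

theorem CopyChain.le_copyCount (hT : IsTreeAction G T) (hpq : p ≠ q) {u v : V} {n : ℕ}
    (h : CopyChain G T p q u v n) : n ≤ copyCount G T p q u v :=
  le_csSup (CopyChain.bddAbove hT hpq u v) h

theorem copyCount_smul_smul (hT : IsTreeAction G T) (g : G) (u v : V) :
    copyCount G T p q (g • u) (g • v) = copyCount G T p q u v := by
  unfold copyCount
  congr 1
  ext n
  exact ⟨fun h => by simpa using h.smul hT g⁻¹, fun h => h.smul hT g⟩

theorem copyCount_add_le (hT : IsTreeAction G T) (hpq : p ≠ q) {u v w : V}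
    (hv : T.dist u v + T.dist v w = T.dist u w) :
    copyCount G T p q u v + copyCount G T p q v w ≤ copyCount G T p q u w := by
  rw [add_comm]
  exact ((copyChain_copyCount hT hpq u v).append hT hv
    (copyChain_copyCount hT hpq v w)).le_copyCount hT hpq

theorem copyCount_le_add (hT : IsTreeAction G T) (hpq : p ≠ q) {u v w : V}
    (hv : T.dist u v + T.dist v w = T.dist u w) :
    copyCount G T p q u w ≤ copyCount G T p q u v + copyCount G T p q v w + 1 := by
  obtain ⟨a, b, h, ha, hb⟩ := (copyChain_copyCount hT hpq u w).exists_split hT hv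
  have := ha.le_copyCount hT hpq
  have := hb.le_copyCount hT hpq
  omega

/-- The counting quasimorphism of the oriented segment from `p` to `q`, with base point `o`. -/
noncomputable def countingQuasimorphism (G : Type*) [Group G] {V : Type*} [MulAction G V]
    (T : SimpleGraph V) (p q o : V) (g : G) : ℤ :=
  copyCount G T p q o (g • o) - copyCount G T p q (g • o) o

theorem countingQuasimorphism_inv (hT : IsTreeAction G T) (o : V) (g : G) :
    countingQuasimorphism G T p q o g⁻¹ = -countingQuasimorphism G T p q o g := by
  have h₁ := copyCount_smul_smul (p := p) (q := q) hT g o (g⁻¹ • o)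
  have h₂ := copyCount_smul_smul (p := p) (q := q) hT g (g⁻¹ • o) o
  rw [smul_inv_smul] at h₁ h₂
  unfold countingQuasimorphism
  omega

/-- Cut the sides of the triangle `o`, `a • o`, `(a * b) • o` at its median. The antisymmetric
counts of the legs cancel, and each side contributes an error of at most 1. -/
theorem abs_countingQuasimorphism_mul_le (hT : IsTreeAction G T) (hpq : p ≠ q) (o : V) (a b : G) :
    |countingQuasimorphism G T p q o (a * b) - countingQuasimorphism G T p q o a -
      countingQuasimorphism G T p q o b| ≤ (3 : ℕ) := by
  have h₁ := copyCount_smul_smul (p := p) (q := q) hT a o (b • o)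
  have h₂ := copyCount_smul_smul (p := p) (q := q) hT a (b • o) o
  unfold countingQuasimorphism
  rw [mul_smul, ← h₁, ← h₂]
  generalize a • b • o = w
  generalize a • o = v
  obtain ⟨m, k₁, k₂, k₃⟩ := hT.isTree.exists_median o v w
  have rev {x y z : V} (h : T.dist x y + T.dist y z = T.dist x z) :
      T.dist z y + T.dist y x = T.dist z x := by
    rw [T.dist_comm (u := z) (v := y), T.dist_comm (u := y) (v := x),
      T.dist_comm (u := z) (v := x)]
    omega
  have l₁ := copyCount_add_le hT hpq k₁
  have l₂ := copyCount_add_le hT hpq k₂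
  have l₃ := copyCount_add_le hT hpq k₃
  have l₄ := copyCount_add_le hT hpq (rev k₁)
  have l₅ := copyCount_add_le hT hpq (rev k₂)
  have l₆ := copyCount_add_le hT hpq (rev k₃)
  have u₁ := copyCount_le_add hT hpq k₁
  have u₂ := copyCount_le_add hT hpq k₂
  have u₃ := copyCount_le_add hT hpq k₃
  have u₄ := copyCount_le_add hT hpq (rev k₁)
  have u₅ := copyCount_le_add hT hpq (rev k₂)
  have u₆ := copyCount_le_add hT hpq (rev k₃)
  rw [abs_le]
  omega

end CopyCount

/-! ### The axis of a hyperbolic element and its reversed copies. -/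

section Axis

variable {G : Type*} [Group G] {V : Type*} [MulAction G V] {T : SimpleGraph V}

theorem translationLength_le (T : SimpleGraph V) (g : G) (v : V) :
    translationLength T g ≤ T.dist v (g • v) :=
  ciInf_le (OrderBot.bddBelow _) v

theorem exists_dist_eq_translationLength [Nonempty V] (T : SimpleGraph V) (g : G) :
    ∃ v : V, T.dist v (g • v) = translationLength T g :=
  Nat.sInf_mem (Set.range_nonempty fun v : V => T.dist v (g • v))

namespace IsTreeAction

variable {g : G} {o : V}

/-- A vertex of least displacement lies on the axis. -/
theorem dist_sq_smul (hT : IsTreeAction G T) (hg : IsHyperbolic T g)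
    (ho : T.dist o (g • o) = translationLength T g) :
    T.dist o (g • g • o) = 2 * translationLength T g := by
  have conn := hT.isTree.connected
  obtain ⟨m, h₁, h₂, h₃⟩ := hT.isTree.exists_median o (g • o) (g • g • o)
  have hpos : 0 < translationLength T g := Nat.pos_of_ne_zero hg
  have hgo : T.dist (g • o) (g • g • o) = translationLength T g := by
    rw [hT.dist_smul_smul, ho]
  have c₁ := T.dist_comm (u := m) (v := g • o)
  -- Otherwise the geodesics from `g • o` to `o` and to `g • g • o` share a first edge, ending at `g
  -- • w`, where `w` follows `o` towards `g • o`. Then `w` has smaller displacement than `o`, or, if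
  -- `|g| = 1`, `g` inverts an edge.
  by_contra hne
  have hm : 0 < T.dist (g • o) m := by omega
  obtain ⟨w, hw₁, hw₂⟩ := hT.isTree.exists_dist_eq (u := o) (v := g • o) (k := 1) (by omega)
  obtain ⟨x, hx₁, hx₂⟩ := hT.isTree.exists_dist_eq (u := g • o) (v := m) (k := 1) (by omega)
  obtain ⟨y, hy₁, hy₂⟩ := hT.isTree.exists_dist_eq (u := g • o) (v := o) (k := 1)
    (by rw [T.dist_comm]; omega)
  have c₂ := T.dist_comm (u := o) (v := g • o)
  have c₃ := T.dist_comm (u := o) (v := m)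
  have hxy : x = y := by
    have a₁ := conn.dist_triangle (u := x) (v := m) (w := o)
    have a₂ := conn.dist_triangle (u := g • o) (v := x) (w := o)
    exact hT.isTree.eq_of_dist_eq (u := g • o) (w := o) (by omega) (by omega) (by omega)
  have hxw : x = g • w := by
    have a₁ := conn.dist_triangle (u := x) (v := m) (w := g • g • o)
    have a₂ := conn.dist_triangle (u := g • o) (v := x) (w := g • g • o)
    have b₁ := hT.dist_smul_smul g o w
    have b₂ := hT.dist_smul_smul g w (g • o)
    exact hT.isTree.eq_of_dist_eq (u := g • o) (w := g • g • o) (by omega) (by omega) (by omega)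
  have hyw : y = g • w := hxy.symm.trans hxw
  rw [hyw] at hy₁ hy₂
  have c₄ := T.dist_comm (u := g • w) (v := g • o)
  have c₅ := T.dist_comm (u := g • w) (v := o)
  have c₆ := T.dist_comm (u := w) (v := g • w)
  have hmin := translationLength_le T g w
  rcases Nat.lt_or_ge (translationLength T g) 2 with hlt | hge
  · have e₁ : w = g • o := conn.dist_eq_zero_iff.1 (by omega)
    have e₂ : g • w = o := conn.dist_eq_zero_iff.1 (by omega)
    refine hT.not_inversion g o (g • o) ?_ ⟨rfl, e₁ ▸ e₂⟩
    rw [← SimpleGraph.dist_eq_one_iff_adj]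
    omega
  · rcases hT.isTree.dist_add_dist_or (u := o) (w := g • o) (x := w) (y := g • w)
      (by omega) (by omega) with h | h <;> omega

/-- Local geodesics are global: those from `o` to `g ^ 2 • o` and from `g • o` to `g ^ (n + 2) • o`
overlap in a segment of length `|g| > 0`. -/
theorem dist_pow_smul (hT : IsTreeAction G T) (hg : IsHyperbolic T g)
    (ho : T.dist o (g • o) = translationLength T g) (n : ℕ) :
    T.dist o (g ^ n • o) = n * translationLength T g := by
  induction n using Nat.strong_induction_on with
  | _ n ih =>
    match n with
    | 0 => simp
    | 1 => simpa using ho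
    | n + 2 =>
      have hsq := hT.dist_sq_smul hg ho
      have hne : g • o ≠ g • g • o := by
        intro h
        rw [← hT.isTree.connected.dist_eq_zero_iff, hT.dist_smul_smul, ho] at h
        exact hg h
      have h₁ := ih (n + 1) (by omega)
      have h₂ := ih n (by omega)
      have a₁ := hT.dist_smul_smul g o (g • o)
      have a₂ := hT.dist_smul_smul g o (g ^ (n + 1) • o)
      have a₃ := hT.dist_smul_smul g (g • o) (g ^ (n + 1) • o)
      have a₄ := hT.dist_smul_smul g o (g ^ n • o)
      rw [← mul_smul g (g ^ (n + 1)), ← pow_succ'] at a₂ a₃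
      rw [← mul_smul g (g ^ n), ← pow_succ'] at a₄
      rw [add_one_mul] at h₁
      change T.dist o (g ^ (n + 1 + 1) • o) = _
      rw [hT.isTree.dist_eq_of_overlap hne (by omega) (by omega), add_mul]
      omega

/-- On the positive half of its axis, `g` is a translation. -/
theorem dist_smul_of_mem_axis (hT : IsTreeAction G T) (hg : IsHyperbolic T g)
    (ho : T.dist o (g • o) = translationLength T g) {n : ℕ} {z : V}
    (hz : T.dist o z + T.dist z (g ^ n • o) = T.dist o (g ^ n • o)) :
    T.dist o (g • z) = T.dist o z + translationLength T g ∧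
      T.dist o (g • z) + T.dist (g • z) (g ^ (n + 1) • o) = T.dist o (g ^ (n + 1) • o) := by
  have conn := hT.isTree.connected
  have h₁ := hT.dist_pow_smul hg ho n
  have h₂ := hT.dist_pow_smul hg ho (n + 1)
  have a₁ := hT.dist_smul_smul g o z
  have a₂ := hT.dist_smul_smul g z (g ^ n • o)
  rw [← mul_smul, ← pow_succ'] at a₂
  have t₁ := conn.dist_triangle (u := o) (v := g • o) (w := g • z)
  have t₂ := conn.dist_triangle (u := o) (v := g • z) (w := g ^ (n + 1) • o)
  rw [add_one_mul] at h₂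
  omega

/-- The position on the axis of the points of a reversed copy of an axis segment. -/
theorem dist_smul_of_reversed (hT : IsTreeAction G T) {h : G} {m n : ℕ}
    (hh : T.dist (g ^ n • o) (h • o) + T.dist (h • o) (h • g ^ m • o) +
      T.dist (h • g ^ m • o) o = T.dist (g ^ n • o) o)
    {z : V} (hz : T.dist o z + T.dist z (g ^ m • o) = T.dist o (g ^ m • o)) :
    T.dist o (h • z) + T.dist o z = T.dist (h • g ^ m • o) o + T.dist o (g ^ m • o) ∧
      T.dist o (h • z) + T.dist (h • z) (g ^ n • o) = T.dist o (g ^ n • o) := by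
  have conn := hT.isTree.connected
  have a₁ := hT.dist_smul_smul h o (g ^ m • o)
  have a₂ := hT.dist_smul_smul h o z
  have a₃ := hT.dist_smul_smul h z (g ^ m • o)
  have t₁ := conn.dist_triangle (u := o) (v := h • g ^ m • o) (w := h • z)
  have t₂ := conn.dist_triangle (u := h • z) (v := h • o) (w := g ^ n • o)
  have t₃ := conn.dist_triangle (u := o) (v := h • z) (w := g ^ n • o)
  have c₁ := T.dist_comm (u := o) (v := h • g ^ m • o)
  have c₂ := T.dist_comm (u := h • g ^ m • o) (v := h • z)
  have c₃ := T.dist_comm (u := h • z) (v := h • o)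
  have c₄ := T.dist_comm (u := h • o) (v := g ^ n • o)
  have c₅ := T.dist_comm (u := o) (v := g ^ n • o)
  omega

/-- In axis coordinates `g` is `t ↦ t + |g|` and `h` is `t ↦ c - t`, so the two shifts cancel. The
copy has length `(m + 1) * |g|` so that `g • z` still lies in the reversed segment. -/
theorem smul_smul_smul_of_reversed (hT : IsTreeAction G T) (hg : IsHyperbolic T g)
    (ho : T.dist o (g • o) = translationLength T g) {h : G} {m n : ℕ}
    (hh : T.dist (g ^ n • o) (h • o) + T.dist (h • o) (h • g ^ (m + 1) • o) +
      T.dist (h • g ^ (m + 1) • o) o = T.dist (g ^ n • o) o)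
    {z : V} (hz : T.dist o z + T.dist z (g ^ m • o) = T.dist o (g ^ m • o)) :
    g • h • g • z = h • z := by
  have conn := hT.isTree.connected
  obtain ⟨b₁, b₂⟩ := hT.dist_smul_of_mem_axis hg ho hz
  obtain ⟨c₁, c₂⟩ := hT.dist_smul_of_reversed hh b₂
  obtain ⟨d₁, d₂⟩ := hT.dist_smul_of_mem_axis hg ho c₂
  have l₁ := hT.dist_pow_smul hg ho m
  have l₂ := hT.dist_pow_smul hg ho (m + 1)
  have l₃ := hT.dist_pow_smul hg ho n
  have l₄ := hT.dist_pow_smul hg ho (n + 1)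
  have s₁ := hT.dist_smul_smul (g ^ m) o (g • o)
  have s₂ := hT.dist_smul_smul (g ^ n) o (g • o)
  rw [← mul_smul, ← pow_succ] at s₁ s₂
  rw [add_one_mul] at l₂ l₄
  have t₁ := conn.dist_triangle (u := z) (v := g ^ m • o) (w := g ^ (m + 1) • o)
  have t₂ := conn.dist_triangle (u := o) (v := z) (w := g ^ (m + 1) • o)
  obtain ⟨e₁, e₂⟩ := hT.dist_smul_of_reversed hh (z := z) (by omega)
  have t₃ := conn.dist_triangle (u := h • z) (v := g ^ n • o) (w := g ^ (n + 1) • o)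
  have t₄ := conn.dist_triangle (u := o) (v := h • z) (w := g ^ (n + 1) • o)
  exact hT.isTree.eq_of_dist_eq (u := o) (w := g ^ (n + 1) • o) d₂ (by omega) (by omega)

theorem isConj_inv_of_reversed (hT : IsTreeAction G T) {K : ℝ}
    (hacyl : IsAcylindricalAction G T K) (hg : IsHyperbolic T g)
    (ho : T.dist o (g • o) = translationLength T g) {h : G} {m n : ℕ}
    (hK : K ≤ (m * translationLength T g : ℕ))
    (hh : T.dist (g ^ n • o) (h • o) + T.dist (h • o) (h • g ^ (m + 1) • o) +
      T.dist (h • g ^ (m + 1) • o) o = T.dist (g ^ n • o) o) : IsConj g g⁻¹ := by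
  obtain ⟨p, hp, hlen⟩ := hT.isTree.connected.exists_path_of_dist o (g ^ m • o)
  have key : h⁻¹ * g * h * g = 1 := by
    refine hacyl _ _ p hp (by rwa [hlen, hT.dist_pow_smul hg ho]) _ fun w hw => ?_
    rw [mul_smul, mul_smul, mul_smul, inv_smul_eq_iff]
    exact hT.smul_smul_smul_of_reversed hg ho hh (hp.dist_add_dist_of_mem_support hT.isTree hw)
  refine isConj_iff.2 ⟨h⁻¹, ?_⟩
  rw [inv_inv]
  exact eq_inv_of_mul_eq_one_left key

/-- The axis vertices are then exactly the `g ^ k • o`, so a reversing `h` followed by a power of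
`g` would swap `o` and `g • o`. -/
theorem not_reversed_of_translationLength_eq_one (hT : IsTreeAction G T)
    (ho : T.dist o (g • o) = translationLength T g) (hg : translationLength T g = 1) {h : G}
    {m n : ℕ} : ¬ T.dist (g ^ n • o) (h • o) + T.dist (h • o) (h • g ^ (m + 1) • o) +
      T.dist (h • g ^ (m + 1) • o) o = T.dist (g ^ n • o) o := by
  intro hh
  have hyp : IsHyperbolic T g := by rw [IsHyperbolic, hg]; exact one_ne_zero
  have conn := hT.isTree.connected
  have l (k : ℕ) : T.dist o (g ^ k • o) = k := by rw [hT.dist_pow_smul hyp ho, hg, mul_one]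
  have l' (k j : ℕ) : T.dist (g ^ k • o) (g ^ (k + j) • o) = j := by
    rw [pow_add, mul_smul, hT.dist_smul_smul, l]
  have on {k j : ℕ} (hkj : k ≤ j) :
      T.dist o (g ^ k • o) + T.dist (g ^ k • o) (g ^ j • o) = T.dist o (g ^ j • o) := by
    have := l' k (j - k)
    rw [Nat.add_sub_cancel' hkj] at this
    rw [l, l, this, Nat.add_sub_cancel' hkj]
  obtain ⟨a₁, a₂⟩ := hT.dist_smul_of_reversed hh (z := o) (by simp)
  obtain ⟨b₁, b₂⟩ := hT.dist_smul_of_reversed hh (z := g • o)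
    (by simpa using on (Nat.le_add_left 1 m))
  rw [l, SimpleGraph.dist_self] at a₁
  rw [l, ho, hg] at b₁
  have hn := l n
  set k := T.dist (h • g ^ (m + 1) • o) o + m with hk
  have e₁ : h • o = g ^ (k + 1) • o :=
    hT.isTree.eq_of_dist_eq a₂ (on (by omega)) (by rw [l]; omega)
  have e₂ : h • g • o = g ^ k • o :=
    hT.isTree.eq_of_dist_eq b₂ (on (by omega)) (by rw [l]; omega)
  refine hT.not_inversion ((g ^ k)⁻¹ * h) o (g • o) ?_ ⟨?_, ?_⟩
  · rw [← SimpleGraph.dist_eq_one_iff_adj, ho, hg]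
  · rw [mul_smul, e₁, inv_smul_eq_iff, pow_succ, mul_smul]
  · rw [mul_smul, e₂, inv_smul_smul]

theorem copyChain_pow (hT : IsTreeAction G T) (hg : IsHyperbolic T g)
    (ho : T.dist o (g • o) = translationLength T g) (M r k : ℕ) :
    CopyChain G T o (g ^ M • o) o (g ^ (M * k + r) • o) k := by
  induction k with
  | zero => exact .zero _ _
  | succ k ih =>
    have ih' := ih.smul hT (g ^ M)
    rw [← mul_smul, ← pow_add, ← add_assoc, ← add_comm (M * k) M, ← mul_add_one] at ih'
    refine .succ 1 ?_ (by rwa [one_smul])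
    have := hT.dist_smul_smul (g ^ M) o (g ^ (M * k + r) • o)
    rw [← mul_smul, ← pow_add, ← add_assoc, ← add_comm (M * k) M, ← mul_add_one] at this
    rw [one_smul, one_smul, this, SimpleGraph.dist_self, hT.dist_pow_smul hg ho,
      hT.dist_pow_smul hg ho, hT.dist_pow_smul hg ho]
    ring

/-- If no translate of the segment from `o` to `g ^ (m + 1) • o` is reversed on the axis, then
`scl g` is at least `1 / (12 * (m + 1))`. -/
theorem le_stableCommutatorLength (hT : IsTreeAction G T) (hg : IsHyperbolic T g)
    (ho : T.dist o (g • o) = translationLength T g) (m : ℕ)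
    (hrev : ∀ (h : G) (n : ℕ), ¬ T.dist (g ^ n • o) (h • o) +
      T.dist (h • o) (h • g ^ (m + 1) • o) + T.dist (h • g ^ (m + 1) • o) o =
        T.dist (g ^ n • o) o) :
    1 / (12 * ((m + 1 : ℕ) : ℝ≥0∞)) ≤ stableCommutatorLength g := by
  have hpq : o ≠ g ^ (m + 1) • o := by
    intro h
    have := hT.isTree.connected.dist_eq_zero_iff.2 h
    rw [hT.dist_pow_smul hg ho, mul_eq_zero] at this
    exact this.elim (by omega) hg
  refine inv_le_stableCommutatorLength (C := 12) m.succ_ne_zero (by norm_num) fun n => ?_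
  -- Without reversed copies nothing is subtracted from the forward count.
  have h₁ : copyCount G T o (g ^ (m + 1) • o) (g ^ n • o) o = 0 := by
    have hc := copyChain_copyCount hT hpq (g ^ n • o) o
    generalize copyCount G T o (g ^ (m + 1) • o) (g ^ n • o) o = c at hc
    cases hc with
    | zero => rfl
    | succ h hd _ => exact absurd hd (hrev h n)
  have h₂ : n / (m + 1) ≤ copyCount G T o (g ^ (m + 1) • o) o (g ^ n • o) := by
    have := hT.copyChain_pow hg ho (m + 1) (n % (m + 1)) (n / (m + 1))
    rw [Nat.div_add_mod] at this
    exact this.le_copyCount hT hpq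
  have h₃ := natAbs_le_mul_commutatorLength three_ne_zero
    (countingQuasimorphism_inv (p := o) (q := g ^ (m + 1) • o) hT o)
    (abs_countingQuasimorphism_mul_le hT hpq o) (g ^ n)
  have h₄ : n / (m + 1) ≤
      (countingQuasimorphism G T o (g ^ (m + 1) • o) o (g ^ n)).natAbs := by
    unfold countingQuasimorphism
    omega
  refine (Nat.cast_le.2 h₄).trans (h₃.trans (le_of_eq ?_))
  norm_num

theorem le_stableCommutatorLength_of_not_isConj (hT : IsTreeAction G T) {K : ℝ}
    (hacyl : IsAcylindricalAction G T K) (hg : IsHyperbolic T g) (hconj : ¬ IsConj g g⁻¹) (m : ℕ)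
    (hm : translationLength T g = 1 ∨ K ≤ (m * translationLength T g : ℕ)) :
    1 / (12 * ((m + 1 : ℕ) : ℝ≥0∞)) ≤ stableCommutatorLength g := by
  have := hT.isTree.connected.nonempty
  obtain ⟨o, ho⟩ := exists_dist_eq_translationLength T g
  refine hT.le_stableCommutatorLength hg ho m fun h n hh => ?_
  rcases hm with hm | hm
  · exact hT.not_reversed_of_translationLength_eq_one ho hm hh
  · exact hconj (hT.isConj_inv_of_reversed hacyl hg ho hm hh)

end IsTreeAction

end Axis

/-! ### Choice of the segment length. -/

theorem mainTheorem6 {G : Type*} [Group G] {V : Type*} [MulAction G V] (T : SimpleGraph V)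
    (hT : IsTreeAction G T) (K : ℝ) (hK : 0 ≤ K) (hacyl : IsAcylindricalAction G T K)
    (N : ℕ) (hN : N = ⌈K / 2 + 1⌉₊) (g : G) (hg : IsHyperbolic T g) :
    (stableCommutatorLength g = 0 ∨ 1 / (12 * (N : ℝ≥0∞)) ≤ stableCommutatorLength g) ∧
    (K ≤ (translationLength T g : ℝ) →
      stableCommutatorLength g = 0 ∨ 1 / 24 ≤ stableCommutatorLength g) ∧
    (stableCommutatorLength g = 0 ↔ IsConj g g⁻¹) := by
  by_cases hconj : IsConj g g⁻¹
  · have h := stableCommutatorLength_eq_zero_of_isConj_inv hconj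
    exact ⟨.inl h, fun _ => .inl h, iff_of_true h hconj⟩
  have hceil : K / 2 + 1 ≤ N := hN ▸ Nat.le_ceil _
  have hN₀ : N ≠ 0 := by
    rintro rfl
    rw [Nat.cast_zero] at hceil
    linarith
  obtain ⟨m, rfl⟩ := Nat.exists_eq_succ_of_ne_zero hN₀
  have hbound : 1 / (12 * ((m + 1 : ℕ) : ℝ≥0∞)) ≤ stableCommutatorLength g := by
    refine hT.le_stableCommutatorLength_of_not_isConj hacyl hg hconj m ?_
    have hpos : 0 < translationLength T g := Nat.pos_of_ne_zero hg
    -- Here `m = N - 1 ≥ K / 2`, so `|g| ≥ 2` gives `m * |g| ≥ K`.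
    rcases Nat.lt_or_ge (translationLength T g) 2 with h | h
    · exact .inl (by omega)
    · right
      have h' : (2 : ℝ) ≤ translationLength T g := by exact_mod_cast h
      push_cast at hceil ⊢
      nlinarith
  refine ⟨.inr hbound, fun h => .inr ?_, iff_of_false (fun h => ?_) hconj⟩
  -- When `|g| ≥ K`, already `m = 1` suffices, and `12 * 2 = 24`.
  · have := hT.le_stableCommutatorLength_of_not_isConj hacyl hg hconj 1 (.inr (by simpa using h))
    norm_num at this ⊢
    exact this
  · rw [h] at hbound
    simp [ENNReal.mul_eq_top] at hbound
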